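/- For $k\in\mathbb N=\{0,1,2,\dots\}$ let $$J_k(x)=\sum_{m\ge 0}\frac{(-1)^m}{m!\,(m+k)!}\Bigl(\frac x2\Bigr)^{2m+k},\qquad I_k(x)=\sum_{m\ge 0}\frac{1}{m!\,(m+k)!}\Bigl(\frac x2\Bigr)^{2m+k}$$ be the Bessel function and the modified Bessel function of the first kind of order $k$, and let $0<j_{k,1}<j_{k,2}<\cdots$ be the positive zeros of $J_k$ in increasing order. For $\kappa>0$ let $0<\alpha_{k,1}(\kappa)<\alpha_{k,2}(\kappa)<\cdots$ be the positive roots, in increasing order, of $$F_k(\alpha)=\frac{\kappa}{\alpha}\,J_k(\alpha)\,I_k'\Bigl(\frac{\kappa}{\alpha}\Bigr)-\alpha\, I_k\Bigl(\frac{\kappa}{\alpha}\Bigr)J_k'(\alpha),\qquad \alpha>0 .$$ Then for every $k\in\mathbb N$ and every integer $\ell\ge 1$ the numbers $j_{k,\ell}$, $j_{k+1,\ell}$ and, for every $\kappa>0$, $\alpha_{k,\ell}(\kappa)$ exist (that is, each of these functions has an $\ell$-th positive root), and $$\lim_{\kappa\to 0^+}\alpha_{k,\ell}(\kappa)=j_{k+1,\ell},\qquad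 \lim_{\kappa\to+\infty}\alpha_{k,\ell}(\kappa)=j_{k,\ell}.$$ -/

import Mathlib

open Filter Topology

noncomputable section

/-- The Bessel function of the first kind `J_k` of integer order `k ≥ 0`, on the real line:
`J_k(x) = ∑_{m ≥ 0} (-1)^m / (m! (m+k)!) (x/2)^(2m+k)` (the series converges for all `x`). -/
def besselJ (k : ℕ) (x : ℝ) : ℝ :=
  ∑' m : ℕ, (-1 : ℝ) ^ m / ((m.factorial : ℝ) * ((m + k).factorial : ℝ)) * (x / 2) ^ (2 * m + k)

/-- The modified Bessel function of the first kind `I_k` of integer order `k ≥ 0`, on the real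
line: `I_k(x) = ∑_{m ≥ 0} 1 / (m! (m+k)!) (x/2)^(2m+k)` (the series converges for all `x`). -/
def besselI (k : ℕ) (x : ℝ) : ℝ :=
  ∑' m : ℕ, 1 / ((m.factorial : ℝ) * ((m + k).factorial : ℝ)) * (x / 2) ^ (2 * m + k)

/-- `x` is the `ℓ`-th positive root of `f` (`ℓ = 1, 2, …`) when the positive roots are listed in
increasing order: `x` is a positive root, and exactly `ℓ` roots of `f` lie in `(0, x]`. -/
def IsNthPosRoot (f : ℝ → ℝ) (ℓ : ℕ) (x : ℝ) : Prop :=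
  0 < x ∧ f x = 0 ∧ {y : ℝ | 0 < y ∧ y ≤ x ∧ f y = 0}.encard = ℓ

theorem IsNthPosRoot.unique {f : ℝ → ℝ} {ℓ : ℕ} {x y : ℝ}
    (hx : IsNthPosRoot f ℓ x) (hy : IsNthPosRoot f ℓ y) : x = y := by
  have key : ∀ a b : ℝ, IsNthPosRoot f ℓ a → IsNthPosRoot f ℓ b → ¬ a < b := by
    intro a b ha hb hab
    have hlt : {y : ℝ | 0 < y ∧ y ≤ a ∧ f y = 0}.encard
        < {y : ℝ | 0 < y ∧ y ≤ b ∧ f y = 0}.encard := by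
      apply Set.Finite.encard_lt_encard
      · exact Set.finite_of_encard_eq_coe ha.2.2
      · refine ⟨fun y h => ⟨h.1, h.2.1.trans hab.le, h.2.2⟩, fun h => ?_⟩
        exact absurd (h ⟨hb.1, le_rfl, hb.2.1⟩).2.1 (not_le.mpr hab)
    rw [ha.2.2, hb.2.2] at hlt
    exact lt_irrefl _ hlt
  exact le_antisymm (not_lt.mp (key y x hy hx)) (not_lt.mp (key x y hx hy))

/-- The `ℓ`-th positive root of `f`: the set below has at most one element, and this is that
element whenever there is one. -/
def nthPosRoot (f : ℝ → ℝ) (ℓ : ℕ) : ℝ :=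
  sInf {x : ℝ | IsNthPosRoot f ℓ x}

theorem IsNthPosRoot.nthPosRoot_eq {f : ℝ → ℝ} {ℓ : ℕ} {x : ℝ}
    (hx : IsNthPosRoot f ℓ x) : nthPosRoot f ℓ = x := by
  have h : {y : ℝ | IsNthPosRoot f ℓ y} = {x} := by
    ext y
    exact ⟨fun hy => IsNthPosRoot.unique hy hx, fun hy => by rw [Set.mem_singleton_iff.mp hy]; exact hx⟩
  rw [nthPosRoot, h, csInf_singleton]

/-- `j_{k,ℓ}`, the `ℓ`-th positive zero of `J_k`. -/
def besselJZero (k ℓ : ℕ) : ℝ :=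
  nthPosRoot (besselJ k) ℓ

/-- The function
`F_k(α) = (κ/α) J_k(α) I_k'(κ/α) - α I_k(κ/α) J_k'(α)`, for `α > 0`, with parameter `κ`. -/
def bucklingF (k : ℕ) (κ α : ℝ) : ℝ :=
  κ / α * besselJ k α * deriv (besselI k) (κ / α)
    - α * besselI k (κ / α) * deriv (besselJ k) α

/-- `α_{k,ℓ}(κ)`, the `ℓ`-th positive root of `F_k`, as a function of `κ`. -/
def bucklingRoot (k ℓ : ℕ) (κ : ℝ) : ℝ :=
  nthPosRoot (bucklingF k κ) ℓ

end

/-! Write `g(x) = x J_{k+1}(x) / J_k(x)` and `r(s) = s I_{k+1}(s) / I_k(s)`. The derivative formulas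
for `J_k` and `I_k` turn `F_k` into a sum without derivatives, and off the zeros of `J_k` the
equation `F_k(x) = 0` reads `g(x) = -r(κ/x)`. Here `r > 0`, while between consecutive zeros of `J_k`
the function `g` increases strictly and vanishes at the intermediate zero of `J_{k+1}`. Every root
therefore lies in some interval `(j_{k,ℓ}, j_{k+1,ℓ})`, and a sign change gives at least one root in
each (`exists_bucklingF_root`, `bucklingF_root_mem_Ioo`).

There is only one root per interval because `g(x) + r(κ/x)` has positive derivative wherever it
vanishes (`ratio_sum_hasDerivAt_pos`); this rests on the Turán-type bound `s² ≤ r² + 2(k+1) r`. The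
limits follow from squeezing `r`: the bound `2(k+1) r ≤ s²` forces `g → 0` at the root as `κ → 0`,
and the Turán-type bound forces `g → -∞` there as `κ → ∞`.

The zeros of `J_k` themselves are enumerated by induction on `k`: an ODE argument shows that `J_0`
has arbitrarily large zeros, and Rolle's theorem makes the zeros of `J_k` and `J_{k+1}` interlace.
-/

/-! ### The common power series. -/

/-- The entire function `E_k(y) = ∑ y^m / (m! (m+k)!)`, through which both kinds of Bessel
functions are expressed. -/
noncomputable def besselE (k : ℕ) (y : ℝ) : ℝ :=
  ∑' m : ℕ, y ^ m / ((m.factorial : ℝ) * ((m + k).factorial : ℝ))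

theorem norm_besselE_term_le (k m : ℕ) (y : ℝ) :
    ‖y ^ m / ((m.factorial : ℝ) * ((m + k).factorial : ℝ))‖ ≤ |y| ^ m / (m.factorial : ℝ) := by
  have h1 : (1 : ℝ) ≤ ((m + k).factorial : ℝ) := by exact_mod_cast (m + k).factorial_pos
  have h2 : (0 : ℝ) < (m.factorial : ℝ) := by exact_mod_cast m.factorial_pos
  rw [Real.norm_eq_abs, abs_div, abs_pow, abs_of_pos (by positivity : (0 : ℝ) < _ * _)]
  gcongr
  nlinarith

theorem summable_besselE (k : ℕ) (y : ℝ) :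
    Summable fun m : ℕ => y ^ m / ((m.factorial : ℝ) * ((m + k).factorial : ℝ)) :=
  Summable.of_norm_bounded (Real.summable_pow_div_factorial |y|)
    fun m => norm_besselE_term_le k m y

/-- Termwise differentiation, dominated on the ball of radius `|y| + 1`; shifting the index by one
turns the differentiated series into that of order `k + 1`. -/
theorem hasDerivAt_besselE (k : ℕ) (y : ℝ) : HasDerivAt (besselE k) (besselE (k + 1) y) y := by
  set R : ℝ := |y| + 1 with hR
  have hR0 : 0 < R := by positivity
  have hu : Summable fun m : ℕ => (m : ℝ) * R ^ (m - 1) / (m.factorial : ℝ) := by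
    rw [← summable_nat_add_iff 1]
    refine (Real.summable_pow_div_factorial R).congr fun m => ?_
    have h2 : (0 : ℝ) < (m.factorial : ℝ) := by exact_mod_cast m.factorial_pos
    rw [Nat.factorial_succ]
    push_cast
    field_simp
  have key := hasDerivAt_tsum_of_isPreconnected (𝕜 := ℝ)
    (g := fun (m : ℕ) (z : ℝ) => z ^ m / ((m.factorial : ℝ) * ((m + k).factorial : ℝ)))
    (g' := fun (m : ℕ) (z : ℝ) => (m : ℝ) * z ^ (m - 1) /
      ((m.factorial : ℝ) * ((m + k).factorial : ℝ)))
    hu Metric.isOpen_ball ((convex_ball (0 : ℝ) R).isPreconnected)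
    (fun m z _ => (hasDerivAt_pow m z).div_const _)
    (fun m z hz => by
      have h1 : (1 : ℝ) ≤ ((m + k).factorial : ℝ) := by exact_mod_cast (m + k).factorial_pos
      have h2 : (0 : ℝ) < (m.factorial : ℝ) := by exact_mod_cast m.factorial_pos
      have hz' : |z| ≤ R := by
        rw [mem_ball_zero_iff, Real.norm_eq_abs] at hz
        exact hz.le
      rw [Real.norm_eq_abs, abs_div, abs_mul, abs_pow, Nat.abs_cast,
        abs_of_pos (by positivity : (0 : ℝ) < (m.factorial : ℝ) * ((m + k).factorial : ℝ))]
      gcongr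
      nlinarith)
    (by simpa using hR0 : (0 : ℝ) ∈ Metric.ball (0 : ℝ) R) (summable_besselE k 0)
    (by rw [mem_ball_zero_iff, Real.norm_eq_abs]; linarith : y ∈ Metric.ball (0 : ℝ) R)
  refine HasDerivAt.congr_deriv key ?_
  have hs : Summable fun m : ℕ => (m : ℝ) * y ^ (m - 1) /
      ((m.factorial : ℝ) * ((m + k).factorial : ℝ)) := by
    rw [← summable_nat_add_iff 1]
    refine (summable_besselE (k + 1) y).congr fun m => ?_
    have h2 : (0 : ℝ) < (m.factorial : ℝ) := by exact_mod_cast m.factorial_pos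
    rw [Nat.factorial_succ, show m + 1 + k = m + (k + 1) by ring]
    push_cast
    field_simp
  rw [hs.tsum_eq_zero_add, besselE]
  simp only [Nat.cast_zero, zero_mul, zero_div, zero_add]
  refine tsum_congr fun m => ?_
  have h2 : (0 : ℝ) < (m.factorial : ℝ) := by exact_mod_cast m.factorial_pos
  rw [Nat.factorial_succ, show m + 1 + k = m + (k + 1) by ring]
  push_cast
  field_simp

/-- Split the factor `m + k + 1` in the coefficients as `(k + 1) + m`; the `m` part, after an index
shift, is the series of order `k + 2`. -/
theorem besselE_recurrence (k : ℕ) (y : ℝ) :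
    besselE k y = (k + 1) * besselE (k + 1) y + y * besselE (k + 2) y := by
  have h2 := summable_besselE (k + 2) y
  have hs : Summable fun m : ℕ => (m : ℝ) * y ^ m /
      ((m.factorial : ℝ) * ((m + (k + 1)).factorial : ℝ)) := by
    rw [← summable_nat_add_iff 1]
    refine (h2.mul_left y).congr fun m => ?_
    have h2 : (0 : ℝ) < (m.factorial : ℝ) := by exact_mod_cast m.factorial_pos
    rw [Nat.factorial_succ, show m + 1 + (k + 1) = m + (k + 2) by ring]
    push_cast
    field_simp
    ring
  have e2 : y * besselE (k + 2) y = ∑' m : ℕ, (m : ℝ) * y ^ m /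
      ((m.factorial : ℝ) * ((m + (k + 1)).factorial : ℝ)) := by
    rw [hs.tsum_eq_zero_add, besselE, ← tsum_mul_left]
    simp only [Nat.cast_zero, zero_mul, zero_div, zero_add]
    refine tsum_congr fun m => ?_
    have h2 : (0 : ℝ) < (m.factorial : ℝ) := by exact_mod_cast m.factorial_pos
    rw [Nat.factorial_succ, show m + 1 + (k + 1) = m + (k + 2) by ring]
    push_cast
    field_simp
    ring
  rw [e2, besselE, besselE, ← tsum_mul_left,
    ← ((summable_besselE (k + 1) y).mul_left _).tsum_add hs]
  refine tsum_congr fun m => ?_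
  have h3 : (0 : ℝ) < ((m + k).factorial : ℝ) := by exact_mod_cast (m + k).factorial_pos
  have h2 : (0 : ℝ) < (m.factorial : ℝ) := by exact_mod_cast m.factorial_pos
  rw [show m + (k + 1) = (m + k) + 1 by ring, Nat.factorial_succ]
  push_cast
  field_simp
  ring

theorem besselE_pos (k : ℕ) {y : ℝ} (hy : 0 ≤ y) : 0 < besselE k y :=
  (summable_besselE k y).tsum_pos (fun m => by positivity) 0 (by simp; positivity)

theorem continuous_besselE (k : ℕ) : Continuous (besselE k) :=
  continuous_iff_continuousAt.2 fun y => (hasDerivAt_besselE k y).continuousAt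

/-! ### Derivatives, recurrences and signs of the Bessel functions. -/

theorem besselJ_eq_besselE (k : ℕ) (x : ℝ) :
    besselJ k x = (x / 2) ^ k * besselE k (-(x / 2) ^ 2) := by
  rw [besselJ, besselE, ← tsum_mul_left]
  refine tsum_congr fun m => ?_
  rw [neg_pow ((x / 2) ^ 2), pow_add, pow_mul]
  ring

theorem besselI_eq_besselE (k : ℕ) (x : ℝ) :
    besselI k x = (x / 2) ^ k * besselE k ((x / 2) ^ 2) := by
  rw [besselI, besselE, ← tsum_mul_left]
  refine tsum_congr fun m => ?_
  rw [pow_add, pow_mul]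
  ring

theorem continuous_besselJ (k : ℕ) : Continuous (besselJ k) := by
  rw [funext (besselJ_eq_besselE k)]
  have := continuous_besselE k
  fun_prop

theorem continuous_besselI (k : ℕ) : Continuous (besselI k) := by
  rw [funext (besselI_eq_besselE k)]
  have := continuous_besselE k
  fun_prop

theorem besselI_pos (k : ℕ) {x : ℝ} (hx : 0 < x) : 0 < besselI k x := by
  rw [besselI_eq_besselE]
  have := besselE_pos k (sq_nonneg (x / 2))
  positivity

theorem hasDerivAt_besselJ (k : ℕ) {x : ℝ} (hx : 0 < x) :
    HasDerivAt (besselJ k) (k / x * besselJ k x - besselJ (k + 1) x) x := by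
  have h2 : HasDerivAt (fun x : ℝ => x / 2) (1 / 2) x := (hasDerivAt_id x).div_const 2
  have h := (h2.fun_pow k).mul
    ((hasDerivAt_besselE k (-(x / 2) ^ 2)).comp x (h2.fun_pow 2).neg)
  rw [funext (besselJ_eq_besselE k), besselJ_eq_besselE (k + 1)]
  refine HasDerivAt.congr_deriv h ?_
  change _ * besselE k (-(x / 2) ^ 2) + _ = _
  rcases k with _ | k
  · simp
    ring
  · push_cast
    field_simp
    ring

theorem hasDerivAt_besselI (k : ℕ) {x : ℝ} (hx : 0 < x) :
    HasDerivAt (besselI k) (k / x * besselI k x + besselI (k + 1) x) x := by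
  have h2 : HasDerivAt (fun x : ℝ => x / 2) (1 / 2) x := (hasDerivAt_id x).div_const 2
  have h := (h2.fun_pow k).mul
    ((hasDerivAt_besselE k ((x / 2) ^ 2)).comp x (h2.fun_pow 2))
  rw [funext (besselI_eq_besselE k), besselI_eq_besselE (k + 1)]
  refine HasDerivAt.congr_deriv h ?_
  change _ * besselE k ((x / 2) ^ 2) + _ = _
  rcases k with _ | k
  · simp
    ring
  · push_cast
    field_simp
    ring

theorem besselJ_recurrence (k : ℕ) (x : ℝ) :
    x * besselJ k x + x * besselJ (k + 2) x = 2 * (k + 1) * besselJ (k + 1) x := by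
  simp only [besselJ_eq_besselE]
  rw [besselE_recurrence k]
  ring

theorem besselI_recurrence (k : ℕ) (x : ℝ) :
    x * besselI k x = 2 * (k + 1) * besselI (k + 1) x + x * besselI (k + 2) x := by
  simp only [besselI_eq_besselE]
  rw [besselE_recurrence k]
  ring

theorem hasDerivAt_besselJ_succ (k : ℕ) {x : ℝ} (hx : 0 < x) :
    HasDerivAt (besselJ (k + 1)) (besselJ k x - (k + 1) / x * besselJ (k + 1) x) x := by
  refine (hasDerivAt_besselJ (k + 1) hx).congr_deriv ?_
  have h := besselJ_recurrence k x
  push_cast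
  field_simp
  linear_combination -h

theorem hasDerivAt_besselI_succ (k : ℕ) {x : ℝ} (hx : 0 < x) :
    HasDerivAt (besselI (k + 1)) (besselI k x - (k + 1) / x * besselI (k + 1) x) x := by
  refine (hasDerivAt_besselI (k + 1) hx).congr_deriv ?_
  have h := besselI_recurrence k x
  push_cast
  field_simp
  linear_combination -h

theorem besselJ_zero_zero : besselJ 0 0 = 1 := by
  have h : besselE 0 0 = 1 := by
    rw [besselE, (summable_besselE 0 0).tsum_eq_zero_add]
    simp
  rw [besselJ_eq_besselE]
  simp [h]

theorem besselJ_succ_zero (k : ℕ) : besselJ (k + 1) 0 = 0 := by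
  rw [besselJ_eq_besselE]
  simp

theorem eventually_besselJ_pos (k : ℕ) : ∃ δ > 0, ∀ x, 0 < x → x < δ → 0 < besselJ k x := by
  have hc : Continuous fun x : ℝ => besselE k (-(x / 2) ^ 2) := by
    have := continuous_besselE k
    fun_prop
  have h0 : 0 < besselE k (-((0 : ℝ) / 2) ^ 2) := besselE_pos k (by simp)
  obtain ⟨δ, hδ, h⟩ := Metric.eventually_nhds_iff.1 (hc.continuousAt.eventually (lt_mem_nhds h0))
  refine ⟨δ, hδ, fun x hx hxd => ?_⟩
  rw [besselJ_eq_besselE]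
  have := h (show dist x 0 < δ by rwa [Real.dist_0_eq_abs, abs_of_pos hx])
  positivity

theorem hasDerivAt_pow_mul_besselJ_succ (k : ℕ) {x : ℝ} (hx : 0 < x) :
    HasDerivAt (fun x => x ^ (k + 1) * besselJ (k + 1) x) (x ^ (k + 1) * besselJ k x) x := by
  refine ((hasDerivAt_pow (k + 1) x).mul (hasDerivAt_besselJ_succ k hx)).congr_deriv ?_
  push_cast
  field_simp
  ring

theorem continuous_pow_mul_besselJ (k : ℕ) : Continuous fun x => x ^ k * besselJ k x := by
  have := continuous_besselJ k
  fun_prop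

/-! ### A positive quadratic form in `J_k` and `J_{k+1}`. -/

/-- A Lagrange-type identity: this form has derivative `2 x J_k²`. -/
theorem hasDerivAt_besselJ_form (k : ℕ) {x : ℝ} (hx : 0 < x) :
    HasDerivAt (fun x => x ^ 2 * besselJ k x ^ 2 - 2 * k * x * besselJ k x * besselJ (k + 1) x
      + x ^ 2 * besselJ (k + 1) x ^ 2) (2 * x * besselJ k x ^ 2) x := by
  have h1 := hasDerivAt_besselJ k hx
  have h2 := hasDerivAt_besselJ_succ k hx
  refine (((hasDerivAt_pow 2 x).mul (h1.fun_pow 2)).sub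
    ((((hasDerivAt_id x).const_mul (2 * (k : ℝ))).mul h1).mul h2) |>.add
    ((hasDerivAt_pow 2 x).mul (h2.fun_pow 2))).congr_deriv ?_
  simp
  field_simp
  ring

/-- As a quadratic form in two free variables this is indefinite when `x < k`, so positivity comes
from integrating the derivative from `0`. It excludes common zeros of `J_k` and `J_{k+1}`, and
divided by `J_k²` it is the numerator of the derivative of `besselJRatio`. -/
theorem besselJ_form_pos (k : ℕ) {x : ℝ} (hx : 0 < x) :
    0 < x ^ 2 * besselJ k x ^ 2 - 2 * k * x * besselJ k x * besselJ (k + 1) x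
      + x ^ 2 * besselJ (k + 1) x ^ 2 := by
  set N : ℝ → ℝ := fun x => x ^ 2 * besselJ k x ^ 2
    - 2 * k * x * besselJ k x * besselJ (k + 1) x + x ^ 2 * besselJ (k + 1) x ^ 2 with hN
  have hc : Continuous N := by
    have := continuous_besselJ k
    have := continuous_besselJ (k + 1)
    fun_prop
  have hd : ∀ y, 0 < y → HasDerivAt N (2 * y * besselJ k y ^ 2) y :=
    fun y hy => hasDerivAt_besselJ_form k hy
  obtain ⟨δ, hδ, hpos⟩ := eventually_besselJ_pos k
  -- On `(0, e)` the function `J_k` is positive, so the growth is strict there; beyond `e`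
  -- monotonicity suffices.
  set e := min δ x with he
  have he0 : 0 < e := lt_min hδ hx
  have h1 : N 0 < N e := by
    refine strictMonoOn_of_deriv_pos (convex_Icc 0 e) hc.continuousOn (fun y hy => ?_)
      (Set.left_mem_Icc.2 he0.le) (Set.right_mem_Icc.2 he0.le) he0
    rw [interior_Icc] at hy
    rw [(hd y hy.1).deriv]
    have := hpos y hy.1 (hy.2.trans_le (min_le_left _ _))
    have := hy.1
    positivity
  have h2 : N e ≤ N x := by
    refine monotoneOn_of_deriv_nonneg (convex_Icc 0 x) hc.continuousOn (fun y hy => ?_)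
      (fun y hy => ?_) ⟨he0.le, min_le_right _ _⟩ (Set.right_mem_Icc.2 hx.le) (min_le_right _ _)
    · rw [interior_Icc] at hy
      exact (hd y hy.1).differentiableAt.differentiableWithinAt
    · rw [interior_Icc] at hy
      rw [(hd y hy.1).deriv]
      have := hy.1
      positivity
  have h0 : N 0 = 0 := by simp [hN]
  change 0 < N x
  linarith

theorem besselJ_succ_ne_zero_of_zero (k : ℕ) {x : ℝ} (hx : 0 < x) (h : besselJ k x = 0) :
    besselJ (k + 1) x ≠ 0 := by
  intro h'
  simpa [h, h'] using besselJ_form_pos k hx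

/-! ### Zeros of `J_0`: arbitrarily large, none below `1`. -/

/-- A pair with `u' = -v` and `(x v)' = x u` cannot have `u > 0` near infinity. -/
theorem not_eventually_pos_of_bessel_pair {u v : ℝ → ℝ} {M : ℝ} (hM : 0 < M)
    (hu : ∀ x, M ≤ x → HasDerivAt u (-v x) x)
    (hv : ∀ x, M ≤ x → HasDerivAt (fun x => x * v x) (x * u x) x)
    (hpos : ∀ x, M ≤ x → 0 < u x) : False := by
  have hmono : ∀ a b, M ≤ a → a ≤ b → a * v a ≤ b * v b := by
    intro a b ha hab
    refine monotoneOn_of_deriv_nonneg (f := fun x => x * v x) (convex_Icc a b)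
      (fun y hy => (hv y (ha.trans hy.1)).continuousAt.continuousWithinAt) (fun y hy => ?_)
      (fun y hy => ?_) (Set.left_mem_Icc.2 hab) (Set.right_mem_Icc.2 hab) hab
    · rw [interior_Icc] at hy
      exact (hv y (ha.trans hy.1.le)).differentiableAt.differentiableWithinAt
    · rw [interior_Icc] at hy
      rw [(hv y (ha.trans hy.1.le)).deriv]
      have := hpos y (ha.trans hy.1.le)
      have : 0 < y := hM.trans_le (ha.trans hy.1.le)
      positivity
  -- Once `v a > 0`, monotonicity of `x v` gives `u' ≤ -c/x`, and `u` decreases at least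
  -- logarithmically to `-∞`. If `v ≤ 0` throughout, `u` stays above `u M`, so `x v` grows at least
  -- linearly and must become positive.
  by_cases hex : ∃ a, M ≤ a ∧ 0 < v a
  · obtain ⟨a, ha, hva⟩ := hex
    have ha0 : 0 < a := hM.trans_le ha
    set c := a * v a with hc
    have hc0 : 0 < c := by positivity
    have hanti : ∀ b, a ≤ b → u b + c * Real.log b ≤ u a + c * Real.log a := by
      intro b hab
      have hd : ∀ y, a ≤ y → HasDerivAt (fun y => u y + c * Real.log y) (-v y + c * y⁻¹) y :=
        fun y hy => (hu y (ha.trans hy)).add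
          ((Real.hasDerivAt_log (ha0.trans_le hy).ne').const_mul c)
      refine antitoneOn_of_deriv_nonpos (f := fun y => u y + c * Real.log y) (convex_Icc a b)
        (fun y hy => (hd y hy.1).continuousAt.continuousWithinAt) (fun y hy => ?_)
        (fun y hy => ?_) (Set.left_mem_Icc.2 hab) (Set.right_mem_Icc.2 hab) hab
      · rw [interior_Icc] at hy
        exact (hd y hy.1.le).differentiableAt.differentiableWithinAt
      · rw [interior_Icc] at hy
        rw [(hd y hy.1.le).deriv]
        have hy0 : 0 < y := ha0.trans hy.1
        have h1 := hmono a y ha hy.1.le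
        have : c * y⁻¹ ≤ v y := by
          rw [← div_eq_mul_inv, div_le_iff₀ hy0]
          linarith
        linarith
    have ht : Tendsto (fun b => c * Real.log b) atTop atTop :=
      Real.tendsto_log_atTop.const_mul_atTop hc0
    obtain ⟨b, hb, hab⟩ := ((ht.eventually_gt_atTop (u a + c * Real.log a)).and
      (eventually_ge_atTop a)).exists
    have := hanti b hab
    have := hpos b (ha.trans hab)
    linarith
  · push Not at hex
    set c := u M with hc
    have hc0 : 0 < c := hpos M le_rfl
    have hu_ge : ∀ b, M ≤ b → c ≤ u b := by
      intro b hb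
      refine monotoneOn_of_deriv_nonneg (convex_Icc M b)
        (fun y hy => (hu y hy.1).continuousAt.continuousWithinAt) (fun y hy => ?_)
        (fun y hy => ?_) (Set.left_mem_Icc.2 hb) (Set.right_mem_Icc.2 hb) hb
      · rw [interior_Icc] at hy
        exact (hu y hy.1.le).differentiableAt.differentiableWithinAt
      · rw [interior_Icc] at hy
        rw [(hu y hy.1.le).deriv]
        have := hex y hy.1.le
        linarith
    have hgrow : ∀ b, M ≤ b → M * v M - c * M * M ≤ b * v b - c * M * b := by
      intro b hb
      have hd : ∀ y, M ≤ y → HasDerivAt (fun y => y * v y - c * M * y) (y * u y - c * M) y :=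
        fun y hy => ((hv y hy).sub ((hasDerivAt_id y).const_mul (c * M))).congr_deriv (by simp)
      refine monotoneOn_of_deriv_nonneg (f := fun y => y * v y - c * M * y) (convex_Icc M b)
        (fun y hy => (hd y hy.1).continuousAt.continuousWithinAt) (fun y hy => ?_)
        (fun y hy => ?_) (Set.left_mem_Icc.2 hb) (Set.right_mem_Icc.2 hb) hb
      · rw [interior_Icc] at hy
        exact (hd y hy.1.le).differentiableAt.differentiableWithinAt
      · rw [interior_Icc] at hy
        rw [(hd y hy.1.le).deriv]
        have := hu_ge y hy.1.le
        nlinarith [hy.1]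
    have ht : Tendsto (fun b => c * M * b) atTop atTop :=
      tendsto_id.const_mul_atTop (by positivity)
    obtain ⟨b, hb, hab⟩ := ((ht.eventually_gt_atTop (c * M * M - M * v M)).and
      (eventually_ge_atTop M)).exists
    have h1 := hgrow b hab
    have h2 := hex b hab
    have : 0 < b := hM.trans_le hab
    nlinarith

theorem hasDerivAt_besselJ_zero {x : ℝ} (hx : 0 < x) :
    HasDerivAt (besselJ 0) (-besselJ 1 x) x :=
  (hasDerivAt_besselJ 0 hx).congr_deriv (by simp)

theorem exists_besselJ_zero_root_gt (M : ℝ) : ∃ x, 0 < x ∧ M < x ∧ besselJ 0 x = 0 := by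
  by_contra! hne
  set A := max M 0 + 1 with hA
  have hA0 : 0 < A := by positivity
  have hMA : M < A := by have := le_max_left M 0; linarith
  have hne' : ∀ x ∈ Set.Ici A, besselJ 0 x ≠ 0 :=
    fun x hx => hne x (hA0.trans_le hx) (hMA.trans_le hx)
  have hd0 : ∀ x, A ≤ x → HasDerivAt (besselJ 0) (-besselJ 1 x) x :=
    fun x hx => hasDerivAt_besselJ_zero (hA0.trans_le hx)
  have hd1 : ∀ x, A ≤ x → HasDerivAt (fun x => x * besselJ 1 x) (x * besselJ 0 x) x :=
    fun x hx => by simpa using hasDerivAt_pow_mul_besselJ_succ 0 (hA0.trans_le hx)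
  have hsign : (∀ x ∈ Set.Ici A, 0 < besselJ 0 x) ∨ ∀ x ∈ Set.Ici A, besselJ 0 x < 0 := by
    by_contra! h
    obtain ⟨⟨x, hx, hx0⟩, y, hy, hy0⟩ := h
    obtain ⟨z, hz, hz0⟩ := isPreconnected_Ici.intermediate_value hx hy
      (continuous_besselJ 0).continuousOn ⟨hx0, hy0⟩
    exact hne' z hz hz0
  rcases hsign with h | h
  · exact not_eventually_pos_of_bessel_pair hA0 hd0 hd1 h
  · refine not_eventually_pos_of_bessel_pair (u := fun x => -besselJ 0 x)
      (v := fun x => -besselJ 1 x) hA0 (fun x hx => (hd0 x hx).neg)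
      (fun x hx => ?_) (fun x hx => neg_pos.2 (h x hx))
    have := (hd1 x hx).neg
    refine HasDerivAt.congr_deriv (f := fun x => x * -besselJ 1 x) ?_ (mul_neg _ _).symm
    simpa only [mul_neg] using! this

/-- The energy `J_0² + J_1²` decreases from `1`, so `J_1 ≤ 1` and `J_0(x) + x` cannot drop below its
initial value `1`. This serves the case `k = 0` of `ratio_sum_hasDerivAt_pos`. -/
theorem one_le_of_besselJ_zero_root {x : ℝ} (hx : 0 < x) (h : besselJ 0 x = 0) : 1 ≤ x := by
  have c0 := continuous_besselJ 0
  have c1 := continuous_besselJ 1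
  have hq : ∀ y, 0 ≤ y → besselJ 0 y ^ 2 + besselJ 1 y ^ 2 ≤ 1 := by
    intro y hy
    have hd : ∀ z, 0 < z → HasDerivAt (fun z => besselJ 0 z ^ 2 + besselJ 1 z ^ 2)
        (-(2 * besselJ 1 z ^ 2 / z)) z := by
      intro z hz
      refine (((hasDerivAt_besselJ_zero hz).fun_pow 2).add
        ((hasDerivAt_besselJ_succ 0 hz).fun_pow 2)).congr_deriv ?_
      simp
      field_simp
      ring
    have := antitoneOn_of_deriv_nonpos (f := fun z => besselJ 0 z ^ 2 + besselJ 1 z ^ 2)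
      (convex_Icc 0 y) (by fun_prop) (fun z hz => ?_)
      (fun z hz => ?_) (Set.left_mem_Icc.2 hy) (Set.right_mem_Icc.2 hy) hy
    · simpa [besselJ_zero_zero, besselJ_succ_zero 0] using this
    · rw [interior_Icc] at hz
      exact (hd z hz.1).differentiableAt.differentiableWithinAt
    · rw [interior_Icc] at hz
      rw [(hd z hz.1).deriv, neg_nonpos]
      have := hz.1
      positivity
  have hd : ∀ z, 0 < z → HasDerivAt (fun z => besselJ 0 z + z) (-besselJ 1 z + 1) z :=
    fun z hz => (hasDerivAt_besselJ_zero hz).add (hasDerivAt_id z)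
  have := monotoneOn_of_deriv_nonneg (f := fun z => besselJ 0 z + z)
    (convex_Icc 0 x) (by fun_prop) (fun z hz => ?_)
    (fun z hz => ?_) (Set.left_mem_Icc.2 hx.le) (Set.right_mem_Icc.2 hx.le) hx.le
  · simpa [besselJ_zero_zero, h] using this
  · rw [interior_Icc] at hz
    exact (hd z hz.1).differentiableAt.differentiableWithinAt
  · rw [interior_Icc] at hz
    rw [(hd z hz.1).deriv]
    nlinarith [hq z hz.1.le, sq_nonneg (besselJ 0 z), sq_nonneg (besselJ 1 z - 1)]

/-! ### Enumeration of roots, and interlacing of the zeros of `J_k` and `J_{k+1}`. -/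

/-- `j 0 < j 1 < ⋯` lists all positive roots of `f`. -/
structure IsPosRootSeq (f : ℝ → ℝ) (j : ℕ → ℝ) : Prop where
  strictMono : StrictMono j
  pos : ∀ n, 0 < j n
  root : ∀ n, f (j n) = 0
  surj : ∀ x, 0 < x → f x = 0 → ∃ n, j n = x

theorem IsPosRootSeq.isNthPosRoot {f : ℝ → ℝ} {j : ℕ → ℝ} (h : IsPosRootSeq f j) (n : ℕ) :
    IsNthPosRoot f (n + 1) (j n) := by
  refine ⟨h.pos n, h.root n, ?_⟩
  have hset : {y : ℝ | 0 < y ∧ y ≤ j n ∧ f y = 0} = j '' Set.Iic n := by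
    ext y
    constructor
    · rintro ⟨hy, hyn, hy0⟩
      obtain ⟨m, rfl⟩ := h.surj y hy hy0
      exact ⟨m, h.strictMono.le_iff_le.1 hyn, rfl⟩
    · rintro ⟨m, hm, rfl⟩
      exact ⟨h.pos m, h.strictMono.monotone hm, h.root m⟩
  rw [hset, h.strictMono.injective.encard_image, ← Finset.coe_Iic, Set.encard_coe_eq_coe_finsetCard]
  simp

theorem IsPosRootSeq.nthPosRoot_eq {f : ℝ → ℝ} {j : ℕ → ℝ} (h : IsPosRootSeq f j) (n : ℕ) :
    nthPosRoot f (n + 1) = j n :=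
  (h.isNthPosRoot n).nthPosRoot_eq

theorem lt_zero_or_exists_mem_Ico {j : ℕ → ℝ} (ht : Tendsto j atTop atTop) (x : ℝ) :
    x < j 0 ∨ ∃ n, x ∈ Set.Ico (j n) (j (n + 1)) := by
  classical
  have hex : ∃ n, x < j n := (ht.eventually_gt_atTop x).exists
  rcases hn : Nat.find hex with _ | n
  · left
    simpa [hn] using Nat.find_spec hex
  · right
    refine ⟨n, not_lt.1 (Nat.find_min hex (by omega)), ?_⟩
    simpa [hn] using Nat.find_spec hex

/-- A continuous function with isolated roots and arbitrarily large roots has its positive roots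
listed by a sequence that tends to infinity. -/
theorem exists_isPosRootSeq {f : ℝ → ℝ} (hf : Continuous f)
    (hright : ∀ a, 0 ≤ a → ∃ δ > 0, ∀ x, a < x → x < a + δ → f x ≠ 0)
    (hleft : ∀ a, 0 < a → ∃ δ > 0, ∀ x, a - δ < x → x < a → f x ≠ 0)
    (hunb : ∀ M, ∃ x, M < x ∧ f x = 0) :
    ∃ j, IsPosRootSeq f j ∧ Tendsto j atTop atTop := by
  have hnext : ∀ a, ∃ z, 0 ≤ a → (a < z ∧ f z = 0 ∧ ∀ y, a < y → y < z → f y ≠ 0) := by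
    intro a
    by_cases ha : 0 ≤ a
    swap
    · exact ⟨0, fun h => absurd h ha⟩
    obtain ⟨δ, hδ, hne⟩ := hright a ha
    obtain ⟨w, hw, hw0⟩ := hunb (a + δ)
    -- No root lies in `(a, a + δ)`, so the next root is the least element of a compact nonempty
    -- set.
    have hcomp : IsCompact (Set.Icc (a + δ) w ∩ f ⁻¹' {0}) :=
      isCompact_Icc.inter_right (isClosed_singleton.preimage hf)
    obtain ⟨z, ⟨hz, hz0⟩, hmin⟩ := hcomp.exists_isLeast ⟨w, ⟨hw.le, le_rfl⟩, hw0⟩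
    refine ⟨z, fun _ => ⟨by linarith [hz.1], hz0, fun y hay hyz hy0 => ?_⟩⟩
    rcases lt_or_ge y (a + δ) with h | h
    · exact hne y hay h hy0
    · exact absurd (hmin ⟨⟨h, hyz.le.trans hz.2⟩, hy0⟩) (not_le.2 hyz)
  choose next hnext using hnext
  let j : ℕ → ℝ := fun n => Nat.rec (next 0) (fun _ a => next a) n
  have hj0 : j 0 = next 0 := rfl
  have hjs : ∀ n, j (n + 1) = next (j n) := fun n => rfl
  have hpos : ∀ n, 0 < j n := by
    intro n
    induction n with
    | zero => exact (hnext 0 le_rfl).1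
    | succ n ih => exact ih.trans (hnext (j n) ih.le).1
  have hroot : ∀ n, f (j n) = 0 := by
    intro n
    cases n with
    | zero => exact (hnext 0 le_rfl).2.1
    | succ n => exact (hnext (j n) (hpos n).le).2.1
  have hmono : StrictMono j := strictMono_nat_of_lt_succ fun n => (hnext (j n) (hpos n).le).1
  have ht : Tendsto j atTop atTop := by
    refine (tendsto_atTop_of_monotone hmono.monotone).resolve_right ?_
    rintro ⟨l, hl⟩
    -- A finite limit would be approached by roots from the left, contradicting isolation.
    have hlt : ∀ n, j n < l := fun n =>
      (hmono n.lt_succ_self).trans_le (hmono.monotone.ge_of_tendsto hl (n + 1))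
    obtain ⟨δ, hδ, hne⟩ := hleft l ((hpos 0).trans (hlt 0))
    obtain ⟨n, hn⟩ := (hl.eventually (lt_mem_nhds (show l - δ < l by linarith))).exists
    exact hne _ hn (hlt n) (hroot n)
  refine ⟨j, ⟨hmono, hpos, hroot, fun x hx hx0 => ?_⟩, ht⟩
  rcases lt_zero_or_exists_mem_Ico ht x with h | ⟨n, hn, hn'⟩
  · exact absurd hx0 ((hnext 0 le_rfl).2.2 x hx h)
  · rcases hn.eq_or_lt with h | h
    · exact ⟨n, h⟩
    · exact absurd hx0 ((hnext (j n) (hpos n).le).2.2 x h hn')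

theorem exists_isPosRootSeq_besselJ_zero :
    ∃ j, IsPosRootSeq (besselJ 0) j ∧ Tendsto j atTop atTop := by
  have hiso : ∀ a, 0 < a → ∃ δ > 0, ∀ x, dist x a < δ → x ≠ a → besselJ 0 x ≠ 0 := by
    intro a ha
    have hev : ∀ᶠ x in 𝓝[≠] a, besselJ 0 x ≠ 0 := by
      by_cases h : besselJ 0 a = 0
      · exact (hasDerivAt_besselJ_zero ha).eventually_ne
          (neg_ne_zero.2 (besselJ_succ_ne_zero_of_zero 0 ha h))
      · exact ((continuous_besselJ 0).continuousAt.eventually_ne h).filter_mono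
          nhdsWithin_le_nhds
    rw [eventually_nhdsWithin_iff, Metric.eventually_nhds_iff] at hev
    obtain ⟨δ, hδ, h⟩ := hev
    exact ⟨δ, hδ, fun x hx hxa => h hx hxa⟩
  refine exists_isPosRootSeq (continuous_besselJ 0) (fun a ha => ?_) (fun a ha => ?_) (fun M => ?_)
  · rcases ha.eq_or_lt with rfl | ha
    · obtain ⟨δ, hδ, h⟩ := eventually_besselJ_pos 0
      exact ⟨δ, hδ, fun x hx hxd => (h x hx (by linarith)).ne'⟩
    · obtain ⟨δ, hδ, h⟩ := hiso a ha
      refine ⟨δ, hδ, fun x hx hxd => h x ?_ hx.ne'⟩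
      rw [Real.dist_eq, abs_of_pos (sub_pos.2 hx)]
      linarith
  · obtain ⟨δ, hδ, h⟩ := hiso a ha
    refine ⟨δ, hδ, fun x hx hxd => h x ?_ hxd.ne⟩
    rw [Real.dist_eq, abs_of_neg (sub_neg.2 hxd)]
    linarith
  · obtain ⟨x, -, hx⟩ := exists_besselJ_zero_root_gt M
    exact ⟨x, hx⟩

/-- Rolle for `x^(k+1) J_{k+1}`. The condition at `a` includes the power so that `a = 0` is allowed
for every `k`. -/
theorem exists_besselJ_root_between_of_succ (k : ℕ) {a b : ℝ} (ha : 0 ≤ a) (hab : a < b)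
    (ha0 : a ^ (k + 1) * besselJ (k + 1) a = 0) (hb0 : besselJ (k + 1) b = 0) :
    ∃ c ∈ Set.Ioo a b, besselJ k c = 0 := by
  obtain ⟨c, hc, h⟩ := exists_hasDerivAt_eq_zero (f := fun x => x ^ (k + 1) * besselJ (k + 1) x) hab
    (continuous_pow_mul_besselJ (k + 1)).continuousOn (by simp [ha0, hb0])
    (fun x hx => hasDerivAt_pow_mul_besselJ_succ k (ha.trans_lt hx.1))
  exact ⟨c, hc, (mul_eq_zero.1 h).resolve_left (pow_ne_zero _ (ha.trans_lt hc.1).ne')⟩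

/-- Rolle for `J_k / x^k`. -/
theorem exists_besselJ_succ_root_between (k : ℕ) {a b : ℝ} (ha : 0 < a) (hab : a < b)
    (ha0 : besselJ k a = 0) (hb0 : besselJ k b = 0) :
    ∃ c ∈ Set.Ioo a b, besselJ (k + 1) c = 0 := by
  have hd : ∀ x, 0 < x → HasDerivAt (fun x => besselJ k x / x ^ k)
      (-besselJ (k + 1) x / x ^ k) x := by
    intro x hx
    refine ((hasDerivAt_besselJ k hx).div (hasDerivAt_pow k x) (pow_ne_zero k hx.ne')).congr_deriv
      ?_
    rcases k with _ | k
    · simp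
    · push_cast
      field_simp
      ring
  obtain ⟨c, hc, h⟩ := exists_hasDerivAt_eq_zero (f := fun x => besselJ k x / x ^ k) hab
    (fun x hx => (hd x (ha.trans_le hx.1)).continuousAt.continuousWithinAt) (by simp [ha0, hb0])
    (fun x hx => hd x (ha.trans hx.1))
  refine ⟨c, hc, ?_⟩
  simpa [pow_ne_zero k (ha.trans hc.1).ne'] using h

/-- Rolle in one direction puts a zero of `J_{k+1}` in each gap. In the other direction, a second
zero in the gap, or one below `j 0` paired with the origin, would create a zero of `J_k` where there
is none. -/
theorem exists_interlacing_besselJ_succ (k : ℕ) {j : ℕ → ℝ} (hj : IsPosRootSeq (besselJ k) j)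
    (ht : Tendsto j atTop atTop) :
    ∃ z, IsPosRootSeq (besselJ (k + 1)) z ∧ ∀ n, z n ∈ Set.Ioo (j n) (j (n + 1)) := by
  choose z hz hz0 using fun n => exists_besselJ_succ_root_between k (hj.pos n)
    (hj.strictMono n.lt_succ_self) (hj.root n) (hj.root (n + 1))
  have hgap : ∀ n x, j n < x → x < j (n + 1) → besselJ k x ≠ 0 := by
    intro n x h1 h2 h0
    obtain ⟨m, rfl⟩ := hj.surj x ((hj.pos n).trans h1) h0
    have := hj.strictMono.lt_iff_lt.1 h1
    have := hj.strictMono.lt_iff_lt.1 h2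
    omega
  refine ⟨z, ⟨strictMono_nat_of_lt_succ fun n => (hz n).2.trans (hz (n + 1)).1,
    fun n => (hj.pos n).trans (hz n).1, hz0, fun x hx hx0 => ?_⟩, hz⟩
  rcases lt_zero_or_exists_mem_Ico ht x with h | ⟨n, hn, hn'⟩
  · obtain ⟨c, hc, hc0⟩ := exists_besselJ_root_between_of_succ k le_rfl hx (by simp) hx0
    obtain ⟨m, rfl⟩ := hj.surj c hc.1 hc0
    exact absurd (hc.2.trans h) (not_lt.2 (hj.strictMono.monotone (Nat.zero_le m)))
  · refine ⟨n, ?_⟩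
    rcases lt_trichotomy (z n) x with h | h | h
    · obtain ⟨c, hc, hc0⟩ := exists_besselJ_root_between_of_succ k ((hj.pos n).trans (hz n).1).le h
        (by simp [hz0]) hx0
      exact absurd hc0 (hgap n c ((hz n).1.trans hc.1) (hc.2.trans hn'))
    · exact h
    · obtain ⟨c, hc, hc0⟩ := exists_besselJ_root_between_of_succ k hx.le h
        (by simp [hx0]) (hz0 n)
      exact absurd hc0 (hgap n c (hn.trans_lt hc.1) (hc.2.trans (hz n).2))

theorem isPosRootSeq_besselJZero_and_tendsto (k : ℕ) :
    IsPosRootSeq (besselJ k) (fun n => besselJZero k (n + 1)) ∧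
      Tendsto (fun n => besselJZero k (n + 1)) atTop atTop := by
  suffices h : ∃ j, IsPosRootSeq (besselJ k) j ∧ Tendsto j atTop atTop by
    obtain ⟨j, hj, ht⟩ := h
    have : (fun n => besselJZero k (n + 1)) = j := funext fun n => hj.nthPosRoot_eq n
    rw [this]
    exact ⟨hj, ht⟩
  induction k with
  | zero => exact exists_isPosRootSeq_besselJ_zero
  | succ k ih =>
    obtain ⟨j, hj, ht⟩ := ih
    obtain ⟨z, hz, hmem⟩ := exists_interlacing_besselJ_succ k hj ht
    exact ⟨z, hz, tendsto_atTop_mono (fun n => (hmem n).1.le) ht⟩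

theorem isPosRootSeq_besselJZero (k : ℕ) :
    IsPosRootSeq (besselJ k) (fun n => besselJZero k (n + 1)) :=
  (isPosRootSeq_besselJZero_and_tendsto k).1

theorem tendsto_besselJZero (k : ℕ) : Tendsto (fun n => besselJZero k (n + 1)) atTop atTop :=
  (isPosRootSeq_besselJZero_and_tendsto k).2

theorem besselJZero_succ_mem_Ioo (k n : ℕ) :
    besselJZero (k + 1) (n + 1) ∈ Set.Ioo (besselJZero k (n + 1)) (besselJZero k (n + 2)) := by
  obtain ⟨z, hz, hmem⟩ :=
    exists_interlacing_besselJ_succ k (isPosRootSeq_besselJZero k) (tendsto_besselJZero k)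
  have : besselJZero (k + 1) (n + 1) = z n := hz.nthPosRoot_eq n
  rw [this]
  exact hmem n

theorem besselJ_ne_zero_of_mem_Ioo (k n : ℕ) {x : ℝ}
    (hx : x ∈ Set.Ioo (besselJZero k (n + 1)) (besselJZero k (n + 2))) : besselJ k x ≠ 0 := by
  intro h0
  have hj := isPosRootSeq_besselJZero k
  obtain ⟨m, rfl⟩ := hj.surj x ((hj.pos n).trans hx.1) h0
  have := hj.strictMono.lt_iff_lt.1 hx.1
  have := hj.strictMono.lt_iff_lt.1 (show _ < (fun n => besselJZero k (n + 1)) (n + 1) from hx.2)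
  omega

theorem besselJ_pos_of_lt (k : ℕ) {x : ℝ} (hx : 0 < x) (hx' : x < besselJZero k 1) :
    0 < besselJ k x := by
  by_contra! h
  obtain ⟨δ, hδ, hpos⟩ := eventually_besselJ_pos k
  set y := min (δ / 2) x
  have hy0 : 0 < y := lt_min (by linarith) hx
  have hy := hpos y hy0 ((min_le_left _ _).trans_lt (by linarith))
  obtain ⟨c, hc, hc0⟩ := intermediate_value_Icc' (min_le_right (δ / 2) x)
    (continuous_besselJ k).continuousOn ⟨h, hy.le⟩
  have hj := isPosRootSeq_besselJZero k
  obtain ⟨m, rfl⟩ := hj.surj c (hy0.trans_le hc.1) hc0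
  exact absurd (hc.2.trans_lt hx') (not_lt.2 (hj.strictMono.monotone (Nat.zero_le m)))

/-! ### The function `F_k` in terms of the two ratios, and bounds on the ratios. -/

theorem bucklingF_eq (k : ℕ) {κ x : ℝ} (hκ : 0 < κ) (hx : 0 < x) :
    bucklingF k κ x = κ / x * besselJ k x * besselI (k + 1) (κ / x)
      + x * besselI k (κ / x) * besselJ (k + 1) x := by
  rw [bucklingF, (hasDerivAt_besselJ k hx).deriv, (hasDerivAt_besselI k (div_pos hκ hx)).deriv]
  field_simp
  ring

/-- The logarithmic-derivative ratio `x J_{k+1}(x) / J_k(x)`. -/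
noncomputable def besselJRatio (k : ℕ) (x : ℝ) : ℝ := x * besselJ (k + 1) x / besselJ k x

/-- The logarithmic-derivative ratio `s I_{k+1}(s) / I_k(s)`. -/
noncomputable def besselIRatio (k : ℕ) (s : ℝ) : ℝ := s * besselI (k + 1) s / besselI k s

theorem bucklingF_eq_mul_ratio (k : ℕ) {κ x : ℝ} (hκ : 0 < κ) (hx : 0 < x)
    (hJ : besselJ k x ≠ 0) :
    bucklingF k κ x = besselJ k x * besselI k (κ / x) *
      (besselJRatio k x + besselIRatio k (κ / x)) := by
  have hI := (besselI_pos k (div_pos hκ hx)).ne'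
  rw [bucklingF_eq k hκ hx, besselJRatio, besselIRatio]
  field_simp
  ring

theorem bucklingF_eq_zero_iff (k : ℕ) {κ x : ℝ} (hκ : 0 < κ) (hx : 0 < x)
    (hJ : besselJ k x ≠ 0) :
    bucklingF k κ x = 0 ↔ besselJRatio k x + besselIRatio k (κ / x) = 0 := by
  have hI := (besselI_pos k (div_pos hκ hx)).ne'
  rw [bucklingF_eq_mul_ratio k hκ hx hJ]
  simp [hJ, hI]

/-- A Riccati equation, which expresses the derivative through the ratio alone;
`hasDerivAt_besselIRatio` is its modified counterpart. -/
theorem hasDerivAt_besselJRatio (k : ℕ) {x : ℝ} (hx : 0 < x) (hJ : besselJ k x ≠ 0) :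
    HasDerivAt (besselJRatio k)
      ((x ^ 2 - 2 * k * besselJRatio k x + besselJRatio k x ^ 2) / x) x := by
  refine (((hasDerivAt_id x).mul (hasDerivAt_besselJ_succ k hx)).div
    (hasDerivAt_besselJ k hx) hJ).congr_deriv ?_
  simp only [besselJRatio, id, Pi.mul_apply]
  field_simp
  ring

theorem hasDerivAt_besselIRatio (k : ℕ) {s : ℝ} (hs : 0 < s) :
    HasDerivAt (besselIRatio k)
      ((s ^ 2 - 2 * k * besselIRatio k s - besselIRatio k s ^ 2) / s) s := by
  have hI := (besselI_pos k hs).ne'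
  refine (((hasDerivAt_id s).mul (hasDerivAt_besselI_succ k hs)).div
    (hasDerivAt_besselI k hs) hI).congr_deriv ?_
  simp only [besselIRatio, id, Pi.mul_apply]
  field_simp
  ring

theorem besselIRatio_pos (k : ℕ) {s : ℝ} (hs : 0 < s) : 0 < besselIRatio k s := by
  have := besselI_pos k hs
  have := besselI_pos (k + 1) hs
  rw [besselIRatio]
  positivity

/-- Drop the positive term `I_{k+2}` from the three-term recurrence. -/
theorem besselIRatio_le (k : ℕ) {s : ℝ} (hs : 0 < s) :
    2 * (k + 1) * besselIRatio k s ≤ s ^ 2 := by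
  have h0 := besselI_pos k hs
  have h2 := besselI_pos (k + 2) hs
  have hrec := besselI_recurrence k s
  have hle : 2 * (k + 1) * besselI (k + 1) s ≤ s * besselI k s := by
    rw [hrec]
    have := mul_pos hs h2
    linarith
  rw [besselIRatio, ← mul_div_assoc, div_le_iff₀ h0]
  nlinarith

/-- A Turán-type inequality for the modified Bessel functions, as a lower bound on the ratio. -/
theorem sq_le_besselIRatio (k : ℕ) {s : ℝ} (hs : 0 < s) :
    s ^ 2 ≤ besselIRatio k s ^ 2 + 2 * (k + 1) * besselIRatio k s := by
  -- `T` is the difference of the two sides multiplied by `I_k²`; it vanishes at `0` and has a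
  -- nonnegative derivative.
  set T : ℝ → ℝ := fun s => s ^ 2 * besselI (k + 1) s ^ 2
    + 2 * (k + 1) * s * besselI (k + 1) s * besselI k s - s ^ 2 * besselI k s ^ 2 with hT
  have hd : ∀ y, 0 < y → HasDerivAt T (2 * y * besselI (k + 1) y ^ 2) y := by
    intro y hy
    have h1 := hasDerivAt_besselI k hy
    have h2 := hasDerivAt_besselI_succ k hy
    refine ((((hasDerivAt_pow 2 y).mul (h2.fun_pow 2)).add
      ((((hasDerivAt_id y).const_mul (2 * ((k : ℝ) + 1))).mul h2).mul h1)).sub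
      ((hasDerivAt_pow 2 y).mul (h1.fun_pow 2))).congr_deriv ?_
    simp
    field_simp
    ring
  have hc : Continuous T := by
    have := continuous_besselI k
    have := continuous_besselI (k + 1)
    fun_prop
  have hmono : T 0 ≤ T s := by
    refine monotoneOn_of_deriv_nonneg (convex_Icc 0 s) hc.continuousOn (fun y hy => ?_)
      (fun y hy => ?_) (Set.left_mem_Icc.2 hs.le) (Set.right_mem_Icc.2 hs.le) hs.le
    · rw [interior_Icc] at hy
      exact (hd y hy.1).differentiableAt.differentiableWithinAt
    · rw [interior_Icc] at hy
      rw [(hd y hy.1).deriv]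
      have := hy.1
      positivity
  have hT0 : T 0 = 0 := by simp [hT]
  have hI := besselI_pos k hs
  have hTs : besselIRatio k s ^ 2 + 2 * (k + 1) * besselIRatio k s - s ^ 2
      = T s / besselI k s ^ 2 := by
    simp only [besselIRatio, hT]
    field_simp
  have : 0 ≤ T s / besselI k s ^ 2 := div_nonneg (hT0 ▸ hmono) (sq_nonneg _)
  linarith

theorem besselJRatio_deriv_pos (k : ℕ) {x : ℝ} (hx : 0 < x) (hJ : besselJ k x ≠ 0) :
    0 < (x ^ 2 - 2 * k * besselJRatio k x + besselJRatio k x ^ 2) / x := by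
  have h : x ^ 2 - 2 * k * besselJRatio k x + besselJRatio k x ^ 2
      = (x ^ 2 * besselJ k x ^ 2 - 2 * k * x * besselJ k x * besselJ (k + 1) x
        + x ^ 2 * besselJ (k + 1) x ^ 2) / besselJ k x ^ 2 := by
    rw [besselJRatio]
    field_simp
  rw [h]
  have := besselJ_form_pos k hx
  positivity

theorem strictMonoOn_besselJRatio (k n : ℕ) :
    StrictMonoOn (besselJRatio k) (Set.Ioo (besselJZero k (n + 1)) (besselJZero k (n + 2))) := by
  have h0 : 0 < besselJZero k (n + 1) := (isPosRootSeq_besselJZero k).pos n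
  refine strictMonoOn_of_deriv_pos (convex_Ioo _ _) (fun x hx => ?_) (fun x hx => ?_)
  · exact (hasDerivAt_besselJRatio k (h0.trans hx.1)
      (besselJ_ne_zero_of_mem_Ioo k n hx)).continuousAt.continuousWithinAt
  · rw [interior_Ioo] at hx
    have hJ := besselJ_ne_zero_of_mem_Ioo k n hx
    rw [(hasDerivAt_besselJRatio k (h0.trans hx.1) hJ).deriv]
    exact besselJRatio_deriv_pos k (h0.trans hx.1) hJ

theorem besselJRatio_besselJZero_succ (k n : ℕ) :
    besselJRatio k (besselJZero (k + 1) (n + 1)) = 0 := by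
  have : besselJ (k + 1) (besselJZero (k + 1) (n + 1)) = 0 :=
    (isPosRootSeq_besselJZero (k + 1)).root n
  simp [besselJRatio, this]

/-- At a root of `F_k(κ, ·)` the function `x J_{k+1}/J_k + s I_{k+1}/I_k`, `s = κ/x`, has positive
derivative. -/
theorem ratio_sum_hasDerivAt_pos (k : ℕ) {κ x : ℝ} (hκ : 0 < κ) (hx : 0 < x)
    (hx1 : k = 0 → 1 < x) (hJ : besselJ k x ≠ 0)
    (h : besselJRatio k x + besselIRatio k (κ / x) = 0) :
    ∃ d > 0, HasDerivAt (fun x => besselJRatio k x + besselIRatio k (κ / x)) d x := by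
  have hs := div_pos hκ hx
  have hdiv : HasDerivAt (fun x : ℝ => κ / x) (-κ / x ^ 2) x := by
    simpa using! (hasDerivAt_const x κ).div (hasDerivAt_id x) hx.ne'
  have hd := (hasDerivAt_besselJRatio k hx hJ).add
    ((hasDerivAt_besselIRatio k hs).comp x hdiv)
  refine ⟨_, ?_, hd⟩
  set s := κ / x with hs'
  set r := besselIRatio k s with hr
  have hr0 : 0 < r := besselIRatio_pos k hs
  have hL : s ^ 2 ≤ r ^ 2 + 2 * (k + 1) * r := sq_le_besselIRatio k hs
  have hg : besselJRatio k x = -r := by linarith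
  have e : (x ^ 2 - 2 * k * besselJRatio k x + besselJRatio k x ^ 2) / x
      + (s ^ 2 - 2 * k * r - r ^ 2) / s * (-κ / x ^ 2)
      = (x ^ 2 - s ^ 2 + 4 * k * r + 2 * r ^ 2) / x := by
    have hκs : κ = s * x := by rw [hs']; field_simp
    rw [hg, hκs]
    field_simp
    ring
  rw [e]
  refine div_pos ?_ hx
  -- By `hL` the numerator is at least `x² + r² + 2(k - 1) r`. This is clearly positive for `k ≥ 1`;
  -- for `k = 0` it equals `x² - 1 + (r - 1)²`, hence the need for `1 < x`.
  rcases Nat.eq_zero_or_pos k with hk | hk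
  · have h1 := hx1 hk
    subst hk
    push_cast at *
    nlinarith [sq_nonneg (r - 1)]
  · have h1 : (1 : ℝ) ≤ k := by exact_mod_cast hk
    nlinarith [mul_nonneg (sub_nonneg.2 h1) hr0.le, pow_pos hx 2, pow_pos hr0 2]

/-- A function whose derivative is positive at each of its zeros has at most one zero. -/
theorem ne_zero_of_deriv_pos_at_zeros {f : ℝ → ℝ} {a b : ℝ} (hab : a < b)
    (hf : ∀ x ∈ Set.Icc a b, DifferentiableAt ℝ f x)
    (hd : ∀ x ∈ Set.Icc a b, f x = 0 → 0 < deriv f x) (ha : f a = 0) : f b ≠ 0 := by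
  intro hb
  -- Starting from `f a = 0`, the function cannot cross below zero, yet a zero at `b` with positive
  -- derivative would make it negative just to the left of `b`.
  have hnonneg : ∀ ⦃x⦄, x ∈ Set.Icc a b → 0 ≤ f x :=
    image_le_of_deriv_right_lt_deriv_boundary' (f := fun _ => (0 : ℝ)) (f' := fun _ => 0)
      continuousOn_const (fun x _ => hasDerivWithinAt_const _ _ _) ha.ge
      (fun x hx => (hf x hx).continuousAt.continuousWithinAt)
      (fun x hx => (hf x (Set.Ico_subset_Icc_self hx)).hasDerivAt.hasDerivWithinAt)
      (fun x hx h => hd x (Set.Ico_subset_Icc_self hx) h.symm)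
  have hsign := eventually_nhdsWithin_sign_eq_of_deriv_pos
    (hd b (Set.right_mem_Icc.2 hab.le) hb) hb
  obtain ⟨y, hy, hya, hyb⟩ := ((hsign.filter_mono nhdsWithin_le_nhds).and
    (Ioo_mem_nhdsLT hab)).exists
  rw [sign_neg (sub_neg.2 hyb), sign_eq_neg_one_iff] at hy
  exact absurd (hnonneg ⟨hya.le, hyb.le⟩) (not_le.2 hy)

/-! ### Exactly one root of `F_k` in each interval `(j_{k,ℓ}, j_{k+1,ℓ})`. -/

theorem exists_zero_of_mul_neg {f : ℝ → ℝ} {a b : ℝ} (hab : a ≤ b)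
    (hf : ContinuousOn f (Set.Icc a b)) (h : f a * f b < 0) : ∃ c ∈ Set.Ioo a b, f c = 0 := by
  rcases mul_neg_iff.1 h with ⟨h1, h2⟩ | ⟨h1, h2⟩
  · exact intermediate_value_Ioo' hab hf ⟨h2, h1⟩
  · exact intermediate_value_Ioo hab hf ⟨h1, h2⟩

/-- The mean value theorem for `x^(k+1) J_{k+1}`, which vanishes at the right end, gives `J_{k+1}`
at the left end the sign opposite to `J_k` inside; and `J_k` keeps its sign up to the right end. -/
theorem besselJ_mul_besselJ_succ_neg (k n : ℕ) :
    besselJ (k + 1) (besselJZero k (n + 1)) * besselJ k (besselJZero (k + 1) (n + 1)) < 0 := by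
  have hj0 : 0 < besselJZero k (n + 1) := (isPosRootSeq_besselJZero k).pos n
  have hroot : besselJ k (besselJZero k (n + 1)) = 0 := (isPosRootSeq_besselJZero k).root n
  have hz0 : besselJ (k + 1) (besselJZero (k + 1) (n + 1)) = 0 :=
    (isPosRootSeq_besselJZero (k + 1)).root n
  have hz := besselJZero_succ_mem_Ioo k n
  have hne := fun x => besselJ_ne_zero_of_mem_Ioo k n (x := x)
  set j := besselJZero k (n + 1)
  set z := besselJZero (k + 1) (n + 1)
  obtain ⟨c, hc, h⟩ := exists_hasDerivAt_eq_slope (fun x => x ^ (k + 1) * besselJ (k + 1) x)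
    (fun x => x ^ (k + 1) * besselJ k x) hz.1 (continuous_pow_mul_besselJ (k + 1)).continuousOn
    (fun x hx => hasDerivAt_pow_mul_besselJ_succ k (hj0.trans hx.1))
  have hc0 : 0 < c := hj0.trans hc.1
  have hzj : 0 < z - j := sub_pos.2 hz.1
  have hsame : 0 < besselJ k c * besselJ k z := by
    by_contra! hle
    have hlt := lt_of_le_of_ne hle
      (mul_ne_zero (hne c ⟨hc.1, hc.2.trans hz.2⟩) (hne z hz))
    obtain ⟨w, hw, hw0⟩ := exists_zero_of_mul_neg hc.2.le (continuous_besselJ k).continuousOn hlt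
    exact hne w ⟨hc.1.trans hw.1, hw.2.trans hz.2⟩ hw0
  have hJ : besselJ (k + 1) j = -(c ^ (k + 1) * (z - j) / j ^ (k + 1)) * besselJ k c := by
    simp only [hz0, mul_zero, zero_sub] at h
    rw [eq_div_iff hzj.ne'] at h
    field_simp
    linear_combination h
  rw [hJ, mul_assoc, neg_mul, neg_lt_zero]
  positivity

/-- At each endpoint one of the two terms of `bucklingF_eq` vanishes, and the surviving ones have
opposite signs. -/
theorem exists_bucklingF_root (k n : ℕ) {κ : ℝ} (hκ : 0 < κ) :
    ∃ x ∈ Set.Ioo (besselJZero k (n + 1)) (besselJZero (k + 1) (n + 1)),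
      bucklingF k κ x = 0 := by
  have hj0 : 0 < besselJZero k (n + 1) := (isPosRootSeq_besselJZero k).pos n
  have hroot : besselJ k (besselJZero k (n + 1)) = 0 := (isPosRootSeq_besselJZero k).root n
  have hz0 : besselJ (k + 1) (besselJZero (k + 1) (n + 1)) = 0 :=
    (isPosRootSeq_besselJZero (k + 1)).root n
  have hz := besselJZero_succ_mem_Ioo k n
  have hneg := besselJ_mul_besselJ_succ_neg k n
  set j := besselJZero k (n + 1)
  set z := besselJZero (k + 1) (n + 1)
  have hzpos : 0 < z := hj0.trans hz.1
  refine exists_zero_of_mul_neg hz.1.le ?_ ?_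
  · have hcont : ContinuousOn (fun x => κ / x * besselJ k x * besselI (k + 1) (κ / x)
        + x * besselI k (κ / x) * besselJ (k + 1) x) (Set.Icc j z) := by
      have hdiv : ContinuousOn (fun x : ℝ => κ / x) (Set.Icc j z) :=
        continuousOn_const.div continuousOn_id fun x hx => (hj0.trans_le hx.1).ne'
      exact ((hdiv.mul (continuous_besselJ k).continuousOn).mul
        ((continuous_besselI (k + 1)).comp_continuousOn hdiv)).add
        ((continuousOn_id.mul ((continuous_besselI k).comp_continuousOn hdiv)).mul
        (continuous_besselJ (k + 1)).continuousOn)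
    exact hcont.congr fun x hx => bucklingF_eq k hκ (hj0.trans_le hx.1)
  · have h1 := besselI_pos k (div_pos hκ hj0)
    have h2 := besselI_pos (k + 1) (div_pos hκ hzpos)
    have e : bucklingF k κ j * bucklingF k κ z
        = (j * besselI k (κ / j) * (κ / z) * besselI (k + 1) (κ / z))
          * (besselJ (k + 1) j * besselJ k z) := by
      rw [bucklingF_eq k hκ hj0, bucklingF_eq k hκ hzpos, hroot, hz0]
      ring
    rw [e]
    exact mul_neg_of_pos_of_neg (by positivity) hneg

/-- Before the first zero of `J_k` both terms of `F_k` are positive; at a zero of `J_k` the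
surviving term is nonzero; from the zero of `J_{k+1}` to the next zero of `J_k` both ratios are
nonnegative and the modified one is positive. -/
theorem bucklingF_root_mem_Ioo (k : ℕ) {κ x : ℝ} (hκ : 0 < κ) (hx : 0 < x)
    (h : bucklingF k κ x = 0) :
    ∃ n, x ∈ Set.Ioo (besselJZero k (n + 1)) (besselJZero (k + 1) (n + 1)) := by
  have hs := div_pos hκ hx
  have hI := besselI_pos k hs
  have hI1 := besselI_pos (k + 1) hs
  rcases lt_zero_or_exists_mem_Ico (tendsto_besselJZero k) x with hlt | ⟨n, hn, hn'⟩
  · have h1 := besselJ_pos_of_lt k hx hlt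
    have h2 := besselJ_pos_of_lt (k + 1) hx (hlt.trans (besselJZero_succ_mem_Ioo k 0).1)
    rw [bucklingF_eq k hκ hx] at h
    have : 0 < κ / x * besselJ k x * besselI (k + 1) (κ / x)
      + x * besselI k (κ / x) * besselJ (k + 1) x := by positivity
    exact absurd h this.ne'
  · have hne : besselJZero k (n + 1) ≠ x := by
      rintro rfl
      have h0 : besselJ k (besselJZero k (n + 1)) = 0 := (isPosRootSeq_besselJZero k).root n
      rw [bucklingF_eq k hκ hx, h0] at h
      simp [hx.ne', hI.ne', besselJ_succ_ne_zero_of_zero k hx h0] at h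
    have hmem : x ∈ Set.Ioo (besselJZero k (n + 1)) (besselJZero k (n + 2)) :=
      ⟨lt_of_le_of_ne hn hne, hn'⟩
    refine ⟨n, hmem.1, ?_⟩
    by_contra! hle
    have hg := (strictMonoOn_besselJRatio k n).monotoneOn (besselJZero_succ_mem_Ioo k n) hmem hle
    rw [besselJRatio_besselJZero_succ] at hg
    have := (bucklingF_eq_zero_iff k hκ hx (besselJ_ne_zero_of_mem_Ioo k n hmem)).1 h
    linarith [besselIRatio_pos k hs]

theorem bucklingF_root_unique (k n : ℕ) {κ x y : ℝ} (hκ : 0 < κ)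
    (hx : x ∈ Set.Ioo (besselJZero k (n + 1)) (besselJZero (k + 1) (n + 1)))
    (hy : y ∈ Set.Ioo (besselJZero k (n + 1)) (besselJZero (k + 1) (n + 1)))
    (hx0 : bucklingF k κ x = 0) (hy0 : bucklingF k κ y = 0) : x = y := by
  wlog hxy : x ≤ y generalizing x y
  · exact (this hy hx hy0 hx0 (le_of_not_ge hxy)).symm
  by_contra hne
  have hj := isPosRootSeq_besselJZero k
  have hj0 : 0 < besselJZero k (n + 1) := hj.pos n
  have hz := besselJZero_succ_mem_Ioo k n
  have hJ : ∀ w, w ∈ Set.Ioo (besselJZero k (n + 1)) (besselJZero (k + 1) (n + 1)) →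
      besselJ k w ≠ 0 :=
    fun w hw => besselJ_ne_zero_of_mem_Ioo k n ⟨hw.1, hw.2.trans hz.2⟩
  have hsub : ∀ w ∈ Set.Icc x y,
      w ∈ Set.Ioo (besselJZero k (n + 1)) (besselJZero (k + 1) (n + 1)) :=
    fun w hw => ⟨hx.1.trans_le hw.1, hw.2.trans_lt hy.2⟩
  refine ne_zero_of_deriv_pos_at_zeros
    (f := fun x => besselJRatio k x + besselIRatio k (κ / x)) (lt_of_le_of_ne hxy hne)
    (fun w hw => ?_) (fun w hw hw0 => ?_)
    ((bucklingF_eq_zero_iff k hκ (hj0.trans hx.1) (hJ x hx)).1 hx0)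
    ((bucklingF_eq_zero_iff k hκ (hj0.trans hy.1) (hJ y hy)).1 hy0)
  · have hw' : 0 < w := hj0.trans (hsub w hw).1
    exact (hasDerivAt_besselJRatio k hw' (hJ w (hsub w hw))).differentiableAt.add
      ((hasDerivAt_besselIRatio k (div_pos hκ hw')).differentiableAt.comp w
        ((differentiableAt_const κ).div differentiableAt_id hw'.ne'))
  · have hw1 : k = 0 → 1 < w := by
      rintro rfl
      exact (one_le_of_besselJ_zero_root hj0 (hj.root n)).trans_lt (hsub w hw).1
    obtain ⟨d, hd0, hd⟩ := ratio_sum_hasDerivAt_pos k hκ (hj0.trans (hsub w hw).1) hw1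
      (hJ w (hsub w hw)) hw0
    rwa [hd.deriv]

theorem exists_isPosRootSeq_bucklingF (k : ℕ) {κ : ℝ} (hκ : 0 < κ) :
    ∃ a, IsPosRootSeq (bucklingF k κ) a ∧
      ∀ n, a n ∈ Set.Ioo (besselJZero k (n + 1)) (besselJZero (k + 1) (n + 1)) := by
  choose a ha ha0 using fun n => exists_bucklingF_root k n hκ
  refine ⟨a, ⟨strictMono_nat_of_lt_succ fun n =>
    ((ha n).2.trans (besselJZero_succ_mem_Ioo k n).2).trans (ha (n + 1)).1,
    fun n => ((isPosRootSeq_besselJZero k).pos n).trans (ha n).1, ha0, fun x hx hx0 => ?_⟩, ha⟩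
  obtain ⟨n, hn⟩ := bucklingF_root_mem_Ioo k hκ hx hx0
  exact ⟨n, bucklingF_root_unique k n hκ (ha n) hn (ha0 n) hx0⟩

theorem isNthPosRoot_bucklingRoot (k n : ℕ) {κ : ℝ} (hκ : 0 < κ) :
    IsNthPosRoot (bucklingF k κ) (n + 1) (bucklingRoot k (n + 1) κ) := by
  obtain ⟨a, ha, -⟩ := exists_isPosRootSeq_bucklingF k hκ
  rw [bucklingRoot, ha.nthPosRoot_eq n]
  exact ha.isNthPosRoot n

theorem bucklingRoot_mem_Ioo (k n : ℕ) {κ : ℝ} (hκ : 0 < κ) :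
    bucklingRoot k (n + 1) κ ∈
      Set.Ioo (besselJZero k (n + 1)) (besselJZero (k + 1) (n + 1)) := by
  obtain ⟨a, ha, hmem⟩ := exists_isPosRootSeq_bucklingF k hκ
  rw [bucklingRoot, ha.nthPosRoot_eq n]
  exact hmem n

theorem besselJRatio_bucklingRoot (k n : ℕ) {κ : ℝ} (hκ : 0 < κ) :
    besselJRatio k (bucklingRoot k (n + 1) κ)
      = -besselIRatio k (κ / bucklingRoot k (n + 1) κ) := by
  have hmem := bucklingRoot_mem_Ioo k n hκ
  have h := isNthPosRoot_bucklingRoot k n hκ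
  refine eq_neg_of_add_eq_zero_left ((bucklingF_eq_zero_iff k hκ h.1 ?_).1 h.2.1)
  exact besselJ_ne_zero_of_mem_Ioo k n ⟨hmem.1, hmem.2.trans (besselJZero_succ_mem_Ioo k n).2⟩

/-! ### The two limits. -/

theorem tendsto_bucklingRoot_zero (k n : ℕ) :
    Tendsto (fun κ : ℝ => bucklingRoot k (n + 1) κ) (𝓝[>] 0)
      (𝓝 (besselJZero (k + 1) (n + 1))) := by
  have hj0 : 0 < besselJZero k (n + 1) := (isPosRootSeq_besselJZero k).pos n
  have hz := besselJZero_succ_mem_Ioo k n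
  have hg := strictMonoOn_besselJRatio k n
  have hgz := besselJRatio_besselJZero_succ k n
  have hroot := fun κ => bucklingRoot_mem_Ioo k n (κ := κ)
  have hratio := fun κ => besselJRatio_bucklingRoot k n (κ := κ)
  set j := besselJZero k (n + 1)
  set z := besselJZero (k + 1) (n + 1)
  refine tendsto_order.2 ⟨fun y hy => ?_, fun y hy => ?_⟩
  swap
  · filter_upwards [self_mem_nhdsWithin] with κ hκ using (hroot κ hκ).2.trans hy
  -- The midpoint keeps `w` inside `(j, z)` even when `y ≤ j`. A root `a ≤ w` would give `r ≥ -g(w)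
  -- > (κ/j)² ≥ (κ/a)²`, against `2(k+1) r ≤ (κ/a)²`.
  set w := max y ((j + z) / 2)
  have hwj : j < w := lt_max_of_lt_right (by linarith [hz.1])
  have hwz : w < z := max_lt hy (by linarith [hz.1])
  have hw : w ∈ Set.Ioo j (besselJZero k (n + 2)) := ⟨hwj, hwz.trans hz.2⟩
  have hgw : besselJRatio k w < 0 := hgz ▸ hg hw hz hwz
  have hsmall : ∀ᶠ κ : ℝ in 𝓝[>] 0, (κ / j) ^ 2 < -besselJRatio k w := by
    have hc : Continuous fun κ : ℝ => (κ / j) ^ 2 := by fun_prop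
    refine (hc.continuousAt.eventually (gt_mem_nhds ?_)).filter_mono nhdsWithin_le_nhds
    simpa using hgw
  filter_upwards [hsmall, self_mem_nhdsWithin] with κ hκs hκ
  have hκ : 0 < κ := hκ
  have ha := hroot κ hκ
  have har := hratio κ hκ
  set a := bucklingRoot k (n + 1) κ
  by_contra! hle
  have ha0 : 0 < a := hj0.trans ha.1
  have hs := div_pos hκ ha0
  have h1 := hg.monotoneOn ⟨ha.1, ha.2.trans hz.2⟩ hw (hle.trans (le_max_left _ _))
  have h2 := besselIRatio_le k hs
  have h3 := besselIRatio_pos k hs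
  have h4 : (κ / a) ^ 2 ≤ (κ / j) ^ 2 := by
    have := ha.1.le
    gcongr
  nlinarith [mul_nonneg k.cast_nonneg h3.le]

theorem tendsto_bucklingRoot_atTop (k n : ℕ) :
    Tendsto (fun κ : ℝ => bucklingRoot k (n + 1) κ) atTop (𝓝 (besselJZero k (n + 1))) := by
  have hj0 : 0 < besselJZero k (n + 1) := (isPosRootSeq_besselJZero k).pos n
  have hz := besselJZero_succ_mem_Ioo k n
  have hg := strictMonoOn_besselJRatio k n
  have hroot := fun κ => bucklingRoot_mem_Ioo k n (κ := κ)
  have hratio := fun κ => besselJRatio_bucklingRoot k n (κ := κ)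
  set j := besselJZero k (n + 1)
  set z := besselJZero (k + 1) (n + 1)
  refine tendsto_order.2 ⟨fun y hy => ?_, fun y hy => ?_⟩
  · filter_upwards [eventually_gt_atTop 0] with κ hκ using hy.trans (hroot κ hκ).1
  set w := min y ((j + z) / 2)
  have hwj : j < w := lt_min hy (by linarith [hz.1])
  have hwz : w < z := min_lt_of_right_lt (by linarith [hz.1])
  have hw : w ∈ Set.Ioo j (besselJZero k (n + 2)) := ⟨hwj, hwz.trans hz.2⟩
  have hzpos : 0 < z := hj0.trans hz.1
  -- A root `a ≥ w` has `r ≤ C`, so the Turán-type bound caps `(κ/a)²`, and with it `(κ/z)²`, by the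
  -- constant in `hlarge`.
  set C := -besselJRatio k w with hC
  have hlarge : ∀ᶠ κ : ℝ in atTop, C ^ 2 + 2 * (k + 1) * C < (κ / z) ^ 2 :=
    ((tendsto_pow_atTop two_ne_zero).comp
      (tendsto_id.atTop_div_const hzpos)).eventually_gt_atTop _
  filter_upwards [hlarge, eventually_gt_atTop 0] with κ hκl hκ
  have ha := hroot κ hκ
  have har := hratio κ hκ
  set a := bucklingRoot k (n + 1) κ
  by_contra! hle
  have ha0 : 0 < a := hj0.trans ha.1
  have hs := div_pos hκ ha0
  have h1 := hg.monotoneOn hw ⟨ha.1, ha.2.trans hz.2⟩ ((min_le_left _ _).trans hle)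
  have h2 := sq_le_besselIRatio k hs
  have h3 := besselIRatio_pos k hs
  have h4 : (κ / z) ^ 2 ≤ (κ / a) ^ 2 := by
    have := ha.2.le
    gcongr
  have h5 : besselIRatio k (κ / a) ≤ C := by linarith
  have h6 : besselIRatio k (κ / a) ^ 2 + 2 * (k + 1) * besselIRatio k (κ / a)
      ≤ C ^ 2 + 2 * (k + 1) * C := by gcongr
  linarith

theorem lemma3p6 (k ℓ : ℕ) (hℓ : 0 < ℓ) :
    -- the zeros and the roots in the claim exist
    IsNthPosRoot (besselJ k) ℓ (besselJZero k ℓ) ∧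
    IsNthPosRoot (besselJ (k + 1)) ℓ (besselJZero (k + 1) ℓ) ∧
    (∀ κ : ℝ, 0 < κ → IsNthPosRoot (bucklingF k κ) ℓ (bucklingRoot k ℓ κ)) ∧
    -- the two limits
    Tendsto (fun κ : ℝ => bucklingRoot k ℓ κ) (𝓝[>] 0) (𝓝 (besselJZero (k + 1) ℓ)) ∧
    Tendsto (fun κ : ℝ => bucklingRoot k ℓ κ) atTop (𝓝 (besselJZero k ℓ)) := by
  obtain ⟨n, rfl⟩ := Nat.exists_eq_add_one_of_ne_zero hℓ.ne'
  exact ⟨(isPosRootSeq_besselJZero k).isNthPosRoot n,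
    (isPosRootSeq_besselJZero (k + 1)).isNthPosRoot n,
    fun κ hκ => isNthPosRoot_bucklingRoot k n hκ,
    tendsto_bucklingRoot_zero k n, tendsto_bucklingRoot_atTop k n⟩
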